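/- **Theorem (Master lower bound).** Let $P(\lambda)=A_0+A_1\lambda+\dots+A_d\lambda^d$ be a matrix polynomial of degree $d$ (so $A_d\neq 0$) with coefficients $A_j\in\mathbb{C}^{n\times n}$ and $\det A_0\neq 0$. Let $\zeta_1,\dots,\zeta_{nd}$ be its eigenvalues, counted with multiplicity and arranged by non-decreasing modulus: the roots of $\det P(\lambda)$, together with the eigenvalue $\infty$ (of modulus $+\infty$) with multiplicity $nd-\deg\det P$. Let $\|\cdot\|$ be a norm on $\mathbb{C}^{n\times n}$ such that (A1) $|\det A|\le\|A\|^n$ for all $A\in\mathbb{C}^{n\times n}$, and put $c=|\det A_0|/\|A_0\|^n$. Let $0<\alpha_1\le\dots\le\alpha_d$ be the tropical roots of $\max_{0\le j\le d}\|A_j\|x^j$, that is, the numbers such that $\max_{0\le j\le d}\|A_j\|x^j=\|A_d\|\prod_{j=1}^d\max(x,\alpha_j)$ for all $x\ge 0$; put $\alpha_0=0$ and $\alpha_{d+1}=+\infty$. For an integer $k\ge 0$ and $0\le\delta\le 1$ let $$\mathcal{U}(k,\delta)=\mathcal{E}(k)\,\frac{1+\delta+\sqrt{k^2(1-\delta)^2+4\delta}}{1-\delta},\qquad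 \mathcal{E}(k)=\Big(\frac{k+1}{k}\Big)^k\ (k\ge 1),\quad \mathcal{E}(0)=1,$$ with $\mathcal{U}(k,1)=+\infty$ and $1/\infty=0$. Let $0\le k^-<k<k^+\le d+1$ be integers, $\delta_-=\alpha_{k^-}/\alpha_k$ and $\delta_+=\alpha_k/\alpha_{k^+}$. Then $\delta_-\le 1$, $\delta_+\le 1$ and $$\frac{|\zeta_1\cdots\zeta_{nk}|}{(\alpha_1\cdots\alpha_k)^n}\ \ge\ c\,L_k^n,\qquad L_k=\max\left(\frac{1}{\mathcal{U}(k^+-k-1,\delta_+)},\ \frac{1}{\mathcal{U}(k-k^-,\delta_-)}\right).$$ Assume moreover that (A2) there are $Q,Q'\in\mathbb{C}^{n\times n}$ with $\det Q=\det Q'=1$ and $\big(\tfrac1n\sum_{i,j}|(QAQ')_{ij}|^2\big)^{1/2}\le\|A\|$ for all $A\in\mathbb{C}^{n\times n}$. Then $L_k$ can be replaced by the constant $$L_k^*=\max\left(\frac{1}{\sqrt{\mathcal{U}(k^+-k-1,\delta_+^2)}},\ \frac{1}{\sqrt{\mathcal{U}(k-k^-,\delta_-^2)}}\right)\ \ge\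 L_k,$$ that is, $|\zeta_1\cdots\zeta_{nk}|/(\alpha_1\cdots\alpha_k)^n\ge c\,(L_k^*)^n$. -/

import Mathlib

open scoped ENNReal Polynomial

noncomputable section

namespace MatPoly

/-- The scalar polynomial `det P(λ)` attached to a matrix polynomial `P(λ) = ∑ A_j λ^j`,
where `A_j = P.coeff j`. -/
def detPoly {n : ℕ} (P : (Matrix (Fin n) (Fin n) ℂ)[X]) : ℂ[X] :=
  (matPolyEquiv.symm P).det

/-- The `n * d` eigenvalues of a matrix polynomial of degree `d` (with `det P ≠ 0`), counted with
multiplicity, as points of the Riemann sphere: the roots of `det P(λ)`, and the point at infinity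
with multiplicity `n * d - deg (det P)`. -/
def eigenvalues {n : ℕ} (P : (Matrix (Fin n) (Fin n) ℂ)[X]) : Multiset (OnePoint ℂ) :=
  (detPoly P).roots.map (fun z : ℂ => (z : OnePoint ℂ)) +
    Multiset.replicate (n * P.natDegree - (detPoly P).natDegree) OnePoint.infty

/-- The modulus of a point of the Riemann sphere; the point at infinity has modulus `∞`. -/
def modulus (z : OnePoint ℂ) : ℝ≥0∞ :=
  OnePoint.elim z ⊤ (fun w : ℂ => ENNReal.ofReal ‖w‖)

/-- `ζ` lists the eigenvalues of `P` with multiplicity, by non-decreasing modulus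
(`ζ 0` is the first one). -/
def IsEigenvalueList {n d : ℕ} (P : (Matrix (Fin n) (Fin n) ℂ)[X])
    (ζ : Fin (n * d) → OnePoint ℂ) : Prop :=
  Finset.univ.val.map ζ = eigenvalues P ∧ Monotone (fun i => modulus (ζ i))

/-- The max-times polynomial `x ↦ max_{0 ≤ j ≤ d} a_j x^j`. -/
def tropEval (d : ℕ) (a : ℕ → ℝ) (x : ℝ) : ℝ :=
  (Finset.range (d + 1)).sup' Finset.nonempty_range_add_one (fun j => a j * x ^ j)

/-- `α` is the non-decreasing list of the tropical roots, with multiplicity, of the max-times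
polynomial `max_{0 ≤ j ≤ d} a_j x^j` of degree `d`: its factorization
`a_d ∏_j max (x, α_j)` as a function of `x ≥ 0`. (`α 0` is the first root.) -/
def IsTropicalRootList (d : ℕ) (a : ℕ → ℝ) (α : Fin d → ℝ) : Prop :=
  Monotone α ∧ (∀ j, 0 ≤ α j) ∧
    ∀ x : ℝ, 0 ≤ x → tropEval d a x = a d * ∏ j, max x (α j)

/-- The extended sequence `α_0 = 0, α_1, …, α_d, α_{d+1} = ∞`. -/
def extSeq {d : ℕ} (α : Fin d → ℝ) : ℕ → ℝ≥0∞
  | 0 => 0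
  | i + 1 => if h : i < d then ENNReal.ofReal (α ⟨i, h⟩) else ⊤

/-- The normalized Frobenius norm `((1/n) ∑ |A_ij|^2)^(1/2)`. -/
def normFrob {n : ℕ} (A : Matrix (Fin n) (Fin n) ℂ) : ℝ :=
  Real.sqrt ((1 / (n : ℝ)) * ∑ i, ∑ j, ‖A i j‖ ^ 2)

/-- A seminorm is a norm when it vanishes only at zero. -/
def IsNorm {n : ℕ} (N : Seminorm ℂ (Matrix (Fin n) (Fin n) ℂ)) : Prop :=
  ∀ A, N A = 0 → A = 0

/-- The condition that `|det A| ≤ ‖A‖^n` for all `A`. -/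
def DetBounded {n : ℕ} (N : Seminorm ℂ (Matrix (Fin n) (Fin n) ℂ)) : Prop :=
  ∀ A : Matrix (Fin n) (Fin n) ℂ, ‖A.det‖ ≤ N A ^ n

/-- The condition that, for some `Q`, `Q'` of determinant one, the normalized Frobenius norm of
`Q A Q'` is at most `‖A‖` for all `A`. -/
def FrobDominated {n : ℕ} (N : Seminorm ℂ (Matrix (Fin n) (Fin n) ℂ)) : Prop :=
  ∃ Q Q' : Matrix (Fin n) (Fin n) ℂ, Q.det = 1 ∧ Q'.det = 1 ∧
    ∀ A : Matrix (Fin n) (Fin n) ℂ, normFrob (Q * A * Q') ≤ N A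

/-- `ℰ(k) = ((k+1)/k)^k` for `k ≥ 1`, and `ℰ(0) = 1`. -/
def calE (k : ℕ) : ℝ := if k = 0 then 1 else (((k : ℝ) + 1) / k) ^ k

/-- `𝒰(k, δ) = ℰ(k) (1 + δ + √(k²(1-δ)² + 4δ)) / (1 - δ)` for `0 ≤ δ ≤ 1`,
with the value `∞` at `δ = 1`. -/
def calU (k : ℕ) (δ : ℝ) : ℝ≥0∞ :=
  ENNReal.ofReal (calE k * (1 + δ + Real.sqrt ((k : ℝ) ^ 2 * (1 - δ) ^ 2 + 4 * δ))) /
    ENNReal.ofReal (1 - δ)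

/-- `max (1/𝒰(k⁺-k-1, δ₊), 1/𝒰(k-k⁻, δ₋))`, with `1/∞ = 0`. -/
def boundL (km k kp : ℕ) (δm δp : ℝ) : ℝ≥0∞ :=
  max (1 / calU (kp - k - 1) δp) (1 / calU (k - km) δm)

/-- `max (1/√𝒰(k⁺-k-1, δ₊²), 1/√𝒰(k-k⁻, δ₋²))`, with `1/∞ = 0`. -/
def boundLStar (km k kp : ℕ) (δm δp : ℝ) : ℝ≥0∞ :=
  max (1 / calU (kp - k - 1) (δp ^ 2) ^ (1 / 2 : ℝ)) (1 / calU (k - km) (δm ^ 2) ^ (1 / 2 : ℝ))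

end MatPoly

end

open scoped ENNReal Polynomial

noncomputable section

namespace MatPoly

/-! Let `p = det P` and let `M_r` be the Mahler measure of `p(rλ)`. Factoring `p` gives `M_r / |det
A_0| = ∏ max(r, |ζ_i|) / |ζ_i|`, where infinite eigenvalues contribute 1. Every factor is at least 1
and at least `r / |ζ_i|`, so `|ζ_1 ⋯ ζ_{nk}| ≥ r^{nk} |det A_0| / M_r`
(`ofReal_le_mahlerMeasure_mul_prod_modulus`).

It remains to bound `M_r` above. Under (A1), `M_r ≤ (∑ ‖A_j‖ r^j)^n`. Under (A2), Hadamard, Jensen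
and Parseval give `M_r² ≤ (∑ ‖A_j‖² r^{2j})^n`. The norms are dominated by the log-concave sequence
`w_j = ‖A_d‖ α_{j+1} ⋯ α_d`, with `w_0 = ‖A_0‖ = w_k α_1 ⋯ α_k`. Hence `∑ w_j r^j ≤ s w_k r^k`
yields the bound `c / s^n`.

For `r = x α_k` or `r = α_k / x` with `x > 1`, geometric series control this sum, and a suitable `x`
gives every `s > 𝒰` (`exists_sum_le_calUReal_right`, `exists_sum_le_calUReal_left`). Under (A2) the
same estimate is applied to `w_j²`, `α_j²`, `δ²`, which accounts for the square root. -/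

/-! ### Jensen, Hadamard, Parseval and the Mahler measure. -/

open Polynomial MeasureTheory Real in
/-- Jensen's inequality for the Mahler measure of a polynomial dominated on the unit circle. -/
theorem mahlerMeasure_sq_le {p : ℂ[X]} (hp : p ≠ 0) {n : ℕ} (hn : n ≠ 0) {f : ℂ → ℝ}
    (hf : Continuous f) (hf0 : ∀ z, 0 ≤ f z) (hpf : ∀ z : ℂ, ‖z‖ = 1 → ‖p.eval z‖ ^ 2 ≤ f z ^ n)
    {C : ℝ} (hC : 0 < C) (hfC : circleAverage f 0 1 ≤ C) : p.mahlerMeasure ^ 2 ≤ C ^ n := by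
  -- The tangent line of `log` at `C` replaces `log (f z)`: it is affine in `f`, so it is continuous
  -- and its average is explicit.
  have hfi : CircleIntegrable (fun z => (n : ℝ) / 2 * (C⁻¹ * f z + (log C - 1))) 0 1 :=
    Continuous.intervalIntegrable (by fun_prop) _ _
  have key : p.logMahlerMeasure ≤
      circleAverage (fun z => (n : ℝ) / 2 * (C⁻¹ * f z + (log C - 1))) 0 1 := by
    rw [logMahlerMeasure_def, circleAverage_def, circleAverage_def, smul_eq_mul, smul_eq_mul]
    refine mul_le_mul_of_nonneg_left ?_ (by positivity)
    refine intervalIntegral.integral_mono_ae_restrict (by positivity)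
      p.intervalIntegrable_mahlerMeasure hfi ?_
    -- At a zero of `p` on the circle, the convention `log 0 = 0` could break the pointwise bound;
    -- these zeros are finite in number.
    have hae : ∀ᵐ θ : ℝ ∂volume.restrict (Set.Icc 0 (2 * π)),
        p.eval (circleMap 0 1 θ) ≠ 0 := by
      rw [← restrict_Ioc_eq_restrict_Icc, ae_restrict_iff' measurableSet_Ioc]
      refine Set.Finite.measure_zero ?_ _
      refine Set.Finite.of_finite_image (f := circleMap 0 1) (p.roots.finite_toSet.subset ?_) ?_
      · rintro z ⟨θ, h, rfl⟩
        simp only [ne_eq, Set.mem_compl_iff, Set.mem_ofPred_eq, Classical.not_imp,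
          Decidable.not_not] at h
        exact (mem_roots hp).mpr h.2
      · have := injOn_circleMap_of_abs_sub_le (c := 0) (R := 1) (a := 0) (b := 2 * π) one_ne_zero
          (by simp [abs_of_pos pi_pos])
        refine this.mono ?_
        intro θ h
        simp only [ne_eq, Set.mem_compl_iff, Set.mem_ofPred_eq, Classical.not_imp,
          Decidable.not_not] at h
        rw [Set.uIoc_of_le (by positivity)]
        exact h.1
    filter_upwards [hae] with θ hθ
    set z := circleMap 0 1 θ
    have hz : ‖z‖ = 1 := by simp [z, circleMap]
    have h1 : 0 < ‖p.eval z‖ ^ 2 := by positivity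
    have hfz : 0 < f z := by
      refine (hf0 z).lt_of_ne fun h => ?_
      have := hpf z hz
      rw [← h, zero_pow hn] at this
      linarith
    have h2 : log (‖p.eval z‖ ^ 2) ≤ log (f z ^ n) := log_le_log h1 (hpf z hz)
    rw [log_pow, log_pow] at h2
    have h3 := log_le_sub_one_of_pos (show 0 < C⁻¹ * f z by positivity)
    rw [log_mul (by positivity) hfz.ne', log_inv] at h3
    have h4 : (n : ℝ) * log (f z) ≤ n * (C⁻¹ * f z + (log C - 1)) :=
      mul_le_mul_of_nonneg_left (by linarith) (by positivity)
    push_cast at h2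
    linarith
  have havg : circleAverage (fun z => (n : ℝ) / 2 * (C⁻¹ * f z + (log C - 1))) 0 1 =
      (n : ℝ) / 2 * (C⁻¹ * circleAverage f 0 1 + (log C - 1)) := by
    have h1 := circleAverage_fun_smul (c := 0) (R := 1) (a := (n : ℝ) / 2)
      (f := fun z => C⁻¹ * f z + (log C - 1))
    have h2 := circleAverage_fun_smul (c := 0) (R := 1) (a := C⁻¹) (f := f)
    simp only [smul_eq_mul] at h1 h2
    rw [h1, circleAverage_fun_add (Continuous.intervalIntegrable (by fun_prop) _ _)
      (Continuous.intervalIntegrable (by fun_prop) _ _), h2, circleAverage_const]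
  have h5 : C⁻¹ * circleAverage f 0 1 ≤ 1 := by
    rw [inv_mul_le_iff₀ hC]; linarith
  have h6 : p.logMahlerMeasure ≤ (n : ℝ) / 2 * log C := by
    rw [havg] at key
    exact key.trans (mul_le_mul_of_nonneg_left (by linarith) (by positivity))
  rw [logMahlerMeasure_eq_log_MahlerMeasure] at h6
  have hM := mahlerMeasure_pos_of_ne_zero hp
  rw [← log_le_log_iff (by positivity) (by positivity), log_pow, log_pow]
  push_cast
  linarith

theorem normFrob_nonneg {n : ℕ} (A : Matrix (Fin n) (Fin n) ℂ) : 0 ≤ normFrob A :=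
  Real.sqrt_nonneg _

theorem normFrob_sq {n : ℕ} (A : Matrix (Fin n) (Fin n) ℂ) :
    normFrob A ^ 2 = (1 / (n : ℝ)) * ∑ i, ∑ j, ‖A i j‖ ^ 2 :=
  Real.sq_sqrt (by positivity)

open Matrix ComplexOrder in
/-- Hadamard's inequality in the form given by the arithmetic-geometric mean inequality. -/
theorem norm_det_sq_le_normFrob {n : ℕ} (hn : n ≠ 0) (B : Matrix (Fin n) (Fin n) ℂ) :
    ‖B.det‖ ^ 2 ≤ (normFrob B ^ 2) ^ n := by
  -- The eigenvalues of `Bᴴ * B` have product `‖det B‖²` and sum `∑ ‖B i j‖²`.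
  have hB : (Bᴴ * B).PosSemidef := posSemidef_conjTranspose_mul_self B
  have hdet : ‖B.det‖ ^ 2 = ∏ i, hB.1.eigenvalues i := by
    have h := hB.1.det_eq_prod_eigenvalues
    rw [det_mul, det_conjTranspose] at h
    have h2 := congrArg (fun z : ℂ => ‖z‖) h
    simp only [norm_mul, norm_star, norm_prod] at h2
    rw [sq, h2]
    exact Finset.prod_congr rfl fun i _ => by
      simp [abs_of_nonneg (hB.eigenvalues_nonneg i)]
  have htr : ∑ i, hB.1.eigenvalues i = ∑ i, ∑ j, ‖B i j‖ ^ 2 := by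
    have h := hB.1.trace_eq_sum_eigenvalues
    have h2 : (Bᴴ * B).trace = ((∑ i, ∑ j, ‖B i j‖ ^ 2 : ℝ) : ℂ) := by
      rw [Finset.sum_comm]
      simp only [trace, diag, mul_apply, conjTranspose_apply]
      push_cast
      refine Finset.sum_congr rfl fun i _ => Finset.sum_congr rfl fun j _ => ?_
      rw [← Complex.conj_mul']; rfl
    rw [h2] at h
    have h3 : ((∑ i, ∑ j, ‖B i j‖ ^ 2 : ℝ) : ℂ) = ((∑ i, hB.1.eigenvalues i : ℝ) : ℂ) := by
      rw [h]; simp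
    exact (Complex.ofReal_injective h3).symm
  have hn' : (0 : ℝ) < n := by positivity
  have ham := Real.geom_mean_le_arith_mean Finset.univ (fun _ : Fin n => (1 : ℝ))
    hB.1.eigenvalues (by simp) (by simpa using Nat.pos_of_ne_zero hn)
    (fun i _ => hB.eigenvalues_nonneg i)
  simp only [Real.rpow_one, one_mul, Finset.sum_const, Finset.card_univ, Fintype.card_fin,
    nsmul_eq_mul, mul_one] at ham
  rw [← hdet, htr] at ham
  rw [normFrob_sq]
  have h0 : 0 ≤ (‖B.det‖ ^ 2) ^ (n : ℝ)⁻¹ := by positivity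
  have := pow_le_pow_left₀ h0 ham n
  rw [Real.rpow_inv_natCast_pow (by positivity) hn] at this
  rwa [one_div, inv_mul_eq_div]

open Polynomial in
theorem detPoly_eval {n : ℕ} (P : (Matrix (Fin n) (Fin n) ℂ)[X]) (z : ℂ) :
    (detPoly P).eval z = (∑ j ∈ Finset.range (P.natDegree + 1), z ^ j • P.coeff j).det := by
  rw [detPoly, _root_.eval_det, AlgEquiv.apply_symm_apply, eval_eq_sum_range]
  congr 1
  refine Finset.sum_congr rfl fun j _ => ?_
  rw [← map_pow, Matrix.scalar_apply, ← Matrix.smul_eq_mul_diagonal]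

theorem detPoly_eval_zero {n : ℕ} (P : (Matrix (Fin n) (Fin n) ℂ)[X]) :
    (detPoly P).eval 0 = (P.coeff 0).det := by
  rw [detPoly_eval, Finset.sum_eq_single_of_mem 0 (by simp)]
  · simp
  · intro j _ hj
    simp [hj]

open Polynomial in
/-- Parseval's identity for matrix polynomials and the normalized Frobenius norm. -/
theorem circleAverage_normFrob_sq {n : ℕ} (m : ℕ) (A : ℕ → Matrix (Fin n) (Fin n) ℂ) :
    Real.circleAverage (fun z : ℂ => normFrob (∑ j ∈ Finset.range m, z ^ j • A j) ^ 2) 0 1 =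
      ∑ j ∈ Finset.range m, normFrob (A j) ^ 2 := by
  have parseval : ∀ a : ℕ → ℂ, Real.circleAverage
      (fun z : ℂ => ‖∑ j ∈ Finset.range m, z ^ j * a j‖ ^ 2) 0 1 =
      ∑ j ∈ Finset.range m, ‖a j‖ ^ 2 := by
    intro a
    have h := sum_sq_norm_coeff_eq_circleAverage
      (∑ j ∈ Finset.range m, Polynomial.monomial j (a j))
    have hc : ∀ i, (∑ j ∈ Finset.range m, Polynomial.monomial j (a j)).coeff i =
        if i ∈ Finset.range m then a i else 0 := by
      intro i
      simp [coeff_monomial]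
    simp only [eval_finsetSum, eval_monomial] at h
    simp only [mul_comm _ (a _)]
    rw [← h]
    rw [Finset.sum_subset (s₂ := Finset.range m)]
    · exact Finset.sum_congr rfl fun i hi => by rw [hc, if_pos hi]
    · intro i hi
      by_contra h'
      rw [mem_support_iff, hc, if_neg h'] at hi
      exact hi rfl
    · intro i _ hi
      rw [notMem_support_iff.mp hi]
      simp
  have hci : ∀ i j, CircleIntegrable
      (fun z : ℂ => ‖∑ l ∈ Finset.range m, z ^ l * A l i j‖ ^ 2) 0 1 := fun i j =>
    Continuous.intervalIntegrable (by fun_prop) _ _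
  have hci' : ∀ i, CircleIntegrable
      (fun z : ℂ => ∑ j, ‖∑ l ∈ Finset.range m, z ^ l * A l i j‖ ^ 2) 0 1 := fun i =>
    Continuous.intervalIntegrable (by fun_prop) _ _
  simp only [normFrob_sq, Matrix.sum_apply, Matrix.smul_apply, smul_eq_mul]
  have h1 := Real.circleAverage_fun_smul (c := 0) (R := 1) (a := 1 / (n : ℝ))
      (f := fun z => ∑ i, ∑ j, ‖∑ l ∈ Finset.range m, z ^ l * A l i j‖ ^ 2)
  simp only [smul_eq_mul] at h1
  rw [h1, Real.circleAverage_fun_sum (fun i _ => hci' i), ← Finset.mul_sum]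
  congr 1
  rw [Finset.sum_comm]
  refine Finset.sum_congr rfl fun i _ => ?_
  rw [Real.circleAverage_fun_sum (fun j _ => hci i j), Finset.sum_comm]
  exact Finset.sum_congr rfl fun j _ => parseval fun l => A l i j

-- The Mahler measure is multiplicative, and a factor `rX - z` contributes `max r ‖z‖`.
open Polynomial in
theorem mahlerMeasure_comp_C_mul_X {p : ℂ[X]} {r : ℝ} (hr : 0 ≤ r) :
    (p.comp (C (r : ℂ) * X)).mahlerMeasure =
      ‖p.leadingCoeff‖ * (p.roots.map fun z => max r ‖z‖).prod := by
  nth_rw 1 [(IsAlgClosed.splits p).eq_prod_roots]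
  rw [mul_comp, C_comp, mahlerMeasure_mul, mahlerMeasure_const, multiset_prod_comp,
    prod_mahlerMeasure_eq_mahlerMeasure_prod, Multiset.map_map, Multiset.map_map]
  congr 3
  ext z
  simp only [Function.comp_apply, sub_comp, X_comp, C_comp]
  rw [sub_eq_add_neg, ← C_neg]
  rcases eq_or_ne (r : ℂ) 0 with h | h
  · have h' : r = 0 := by exact_mod_cast h
    subst h'
    simp [-map_neg]
  · rw [mahlerMeasure_C_mul_X_add_C h]
    simp [abs_of_nonneg hr]

/-! ### The function `𝒰` and the choice of the geometric parameter. -/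

/-- The finite values of `calU`. -/
def calUReal (k : ℕ) (δ : ℝ) : ℝ :=
  calE k * (1 + δ + Real.sqrt ((k : ℝ) ^ 2 * (1 - δ) ^ 2 + 4 * δ)) / (1 - δ)

theorem one_le_calE (k : ℕ) : 1 ≤ calE k := by
  unfold calE
  split_ifs with h
  · exact le_rfl
  · have : (0 : ℝ) < k := by positivity
    exact one_le_pow₀ (by rw [le_div_iff₀ this]; linarith)

theorem calUReal_pos (k : ℕ) {δ : ℝ} (h0 : 0 ≤ δ) (h1 : δ < 1) : 0 < calUReal k δ := by
  have h2 := one_le_calE k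
  have h3 : 0 < 1 - δ := by linarith
  unfold calUReal
  have := Real.sqrt_nonneg ((k : ℝ) ^ 2 * (1 - δ) ^ 2 + 4 * δ)
  have h4 : 0 < calE k := by linarith
  positivity

theorem calU_eq_ofReal {k : ℕ} {δ : ℝ} (h1 : δ < 1) : calU k δ = ENNReal.ofReal (calUReal k δ) := by
  rw [calU, calUReal, ENNReal.ofReal_div_of_pos (by linarith)]

theorem calU_one (k : ℕ) : calU k 1 = ⊤ := by
  have h2 := one_le_calE k
  have h4 : 0 < calE k := by linarith
  rw [calU, sub_self, ENNReal.ofReal_zero, ENNReal.div_zero]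
  rw [ne_eq, ENNReal.ofReal_eq_zero, not_le]
  positivity

/-- The infimum over `x > 1` of `x ^ k * (x / (x - 1) + x * δ / (1 - x * δ))` is at
most `𝒰(k, δ)`. -/
theorem exists_geom_bound_le_calUReal (k : ℕ) {δ : ℝ} (h0 : 0 ≤ δ) (h1 : δ < 1) {s : ℝ}
    (hs : calUReal k δ < s) :
    ∃ x : ℝ, 1 < x ∧ x * δ < 1 ∧ x ^ k * (x / (x - 1) + x * δ / (1 - x * δ)) ≤ s := by
  -- Here the infimum 1 of `x / (x - 1)` is approached only as `x → ∞`; this is why `s` lies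
  -- strictly above `𝒰`.
  by_cases hk : k = 0 ∧ δ = 0
  · obtain ⟨rfl, rfl⟩ := hk
    have hs1 : 1 < s := by simpa [calUReal, calE] using hs
    refine ⟨s / (s - 1), ?_, by simp, ?_⟩
    · rw [lt_div_iff₀ (by linarith)]; linarith
    · have : s - 1 ≠ 0 := by linarith
      have h : s / (s - 1) - 1 = 1 / (s - 1) := by field_simp; ring
      rw [h]
      simp only [pow_zero, one_mul, mul_zero, zero_div, add_zero]
      rw [div_div_div_cancel_right₀ this, div_one]
  set K : ℝ := (k : ℝ) with hK
  have hK0 : 0 ≤ K := Nat.cast_nonneg k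
  set D := Real.sqrt (K ^ 2 * (1 - δ) ^ 2 + 4 * δ) with hD
  have hD0 : 0 ≤ D := Real.sqrt_nonneg _
  have hD2 : D ^ 2 = K ^ 2 * (1 - δ) ^ 2 + 4 * δ := Real.sq_sqrt (by positivity)
  have h1δ : 0 < 1 - δ := by linarith
  have hKδ : K * (1 - δ) ≤ D := by
    exact abs_le_of_sq_le_sq' (by nlinarith) hD0 |>.2
  -- For the `x` chosen below, `hDlt` means `1 < x`, `hE` makes its denominator positive, and `hDgt`
  -- means `x * δ < 1`.
  have hDlt : D < K * (1 - δ) + 2 := by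
    refine lt_of_pow_lt_pow_left₀ 2 (by positivity) ?_
    nlinarith [mul_nonneg hK0 h1δ.le]
  have hE : 0 < K * (1 + δ) + D := by
    rcases h0.eq_or_lt with h | h
    · have : k ≠ 0 := fun h' => hk ⟨h', h.symm⟩
      have : 0 < K := by positivity
      positivity
    · have : 0 < D := Real.sqrt_pos.mpr (by positivity)
      positivity
  have hDgt : 2 * δ - K * (1 - δ) < D := by
    rcases h0.eq_or_lt with h | h
    · rw [← h] at hE hKδ ⊢
      have : k ≠ 0 := fun h' => hk ⟨h', h.symm⟩
      have : 0 < K := by positivity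
      linarith
    · by_contra hcon
      push Not at hcon
      have := pow_le_pow_left₀ hD0 hcon 2
      nlinarith [mul_nonneg (mul_nonneg hK0 h1δ.le) h.le, mul_pos h h1δ]
  -- A critical point of the function of `x`: a root of `(K-1)δx² - K(1+δ)x + (K+1) = 0`,
  -- rationalized so that `δ = 0` and `K = 1` need no separate formula.
  set x := 2 * (K + 1) / (K * (1 + δ) + D) with hx
  have hx1 : 1 < x := by rw [hx, lt_div_iff₀ hE]; linarith
  have hxδ : x * δ < 1 := by rw [hx, div_mul_eq_mul_div, div_lt_one hE]; linarith
  refine ⟨x, hx1, hxδ, le_trans (b := x ^ k * ((1 + δ + D) / (1 - δ))) (le_of_eq ?_)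
    (hs.le.trans' ?_)⟩
  · congr 1
    have hxE : x * (K * (1 + δ) + D) = 2 * (K + 1) := by rw [hx]; field_simp
    have e1 : x - 1 ≠ 0 := by linarith
    have e2 : 1 - x * δ ≠ 0 := by linarith
    have : x / (x - 1) + x * δ / (1 - x * δ) = x * (1 - δ) / ((x - 1) * (1 - x * δ)) := by
      field_simp
      ring
    rw [this, div_eq_div_iff (by positivity) h1δ.ne']
    have hE2 : (K * (1 + δ) + D) ^ 2 ≠ 0 := by positivity
    have ex : (x - 1) * (K * (1 + δ) + D) = K * (1 - δ) + 2 - D := by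
      linear_combination hxE
    have ed : (1 - x * δ) * (K * (1 + δ) + D) = K * (1 - δ) - 2 * δ + D := by
      linear_combination (-δ) * hxE
    refine mul_right_cancel₀ hE2 ?_
    have lhs : x * (1 - δ) * (1 - δ) * (K * (1 + δ) + D) ^ 2 =
        2 * (K + 1) * (1 - δ) ^ 2 * (K * (1 + δ) + D) := by
      linear_combination (1 - δ) ^ 2 * (K * (1 + δ) + D) * hxE
    have rhs : (1 + δ + D) * ((x - 1) * (1 - x * δ)) * (K * (1 + δ) + D) ^ 2 =
        (1 + δ + D) * (K * (1 - δ) + 2 - D) * (K * (1 - δ) - 2 * δ + D) := by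
      rw [← ex, ← ed]; ring
    rw [lhs, rhs]
    linear_combination (D - 1 - δ) * hD2
  -- The only loss is `x ≤ (K+1)/K`, which follows from `D ≥ K(1-δ)`.
  · unfold calUReal
    rw [mul_div_assoc]
    refine mul_le_mul_of_nonneg_right ?_ (by positivity)
    unfold calE
    split_ifs with h
    · simp [h]
    · refine pow_le_pow_left₀ (by linarith) ?_ k
      have : 0 < K := by positivity
      rw [hx, div_le_div_iff₀ hE this]
      nlinarith

/-- This gives `L_k ≤ L_k^*`. Since `δ ≤ (1+δ)²`, the square root at `δ²` is at most `(1+δ)` times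
the one at `δ`; the rest uses `1 ≤ ℰ(k)`. -/
theorem calUReal_sq_le (k : ℕ) {δ : ℝ} (h0 : 0 ≤ δ) (h1 : δ < 1) :
    calUReal k (δ ^ 2) ≤ calUReal k δ ^ 2 := by
  have hE := one_le_calE k
  set E := calE k
  unfold calUReal
  set K : ℝ := (k : ℝ) with hK
  set D := Real.sqrt (K ^ 2 * (1 - δ) ^ 2 + 4 * δ) with hD
  have hD0 : 0 ≤ D := Real.sqrt_nonneg _
  have h1δ : 0 < 1 - δ := by linarith
  have hsq : Real.sqrt (K ^ 2 * (1 - δ ^ 2) ^ 2 + 4 * δ ^ 2) ≤ (1 + δ) * D := by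
    refine Real.sqrt_le_iff.mpr ⟨by positivity, ?_⟩
    rw [mul_pow, Real.sq_sqrt (by positivity)]
    nlinarith [pow_nonneg h0 2, pow_nonneg h0 3]
  have h2 : 0 < 1 - δ ^ 2 := by nlinarith
  rw [div_pow, div_le_div_iff₀ h2 (by positivity)]
  have e : (1 : ℝ) - δ ^ 2 = (1 - δ) * (1 + δ) := by ring
  rw [mul_pow]
  set S := Real.sqrt (K ^ 2 * (1 - δ ^ 2) ^ 2 + 4 * δ ^ 2)
  have hS : 0 ≤ S := Real.sqrt_nonneg _
  have h3 : (1 + δ ^ 2 + S) * (1 - δ) ≤ (1 + δ + D) ^ 2 * (1 + δ) := by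
    calc (1 + δ ^ 2 + S) * (1 - δ) ≤ (1 + δ ^ 2 + S) * 1 := by gcongr; linarith
      _ ≤ (1 + δ + D) ^ 2 * 1 := by nlinarith [mul_nonneg h0 hD0]
      _ ≤ _ := by gcongr; linarith
  have h4 : E ≤ E ^ 2 := by nlinarith
  calc E * (1 + δ ^ 2 + S) * (1 - δ) ^ 2 = E * ((1 + δ ^ 2 + S) * (1 - δ)) * (1 - δ) := by ring
    _ ≤ E ^ 2 * ((1 + δ + D) ^ 2 * (1 + δ)) * (1 - δ) := by gcongr
    _ = _ := by rw [e]; ring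

/-! ### Sums of log-concave sequences near one slope. -/

/-- A finite sequence that grows at least by the factor `x` up to `k`, at most by the factor `x`
on the next `K` steps, and at most by the factor `q < 1` afterwards. -/
theorem sum_le_of_ratio_bounds {T : ℕ → ℝ} {k K d : ℕ} {x q : ℝ} (hT : ∀ j, 0 ≤ T j)
    (hx : 1 < x) (hq0 : 0 ≤ q) (hq : q < 1) (hkd : k + K ≤ d)
    (h1 : ∀ j < k, x * T j ≤ T (j + 1))
    (h2 : ∀ j, k ≤ j → j < k + K → T (j + 1) ≤ x * T j)
    (h3 : ∀ j, k + K ≤ j → j < d → T (j + 1) ≤ q * T j) :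
    ∑ j ∈ Finset.range (d + 1), T j ≤ T k * (x ^ K * (x / (x - 1) + q / (1 - q))) := by
  have hx0 : 0 < x := by linarith
  have low : ∀ i ≤ k, T (k - i) * x ^ i ≤ T k := by
    intro i
    induction i with
    | zero => simp
    | succ i ih =>
      intro hi
      have h := h1 (k - (i + 1)) (by omega)
      rw [show k - (i + 1) + 1 = k - i by omega] at h
      calc T (k - (i + 1)) * x ^ (i + 1) = (x * T (k - (i + 1))) * x ^ i := by ring
        _ ≤ T (k - i) * x ^ i := by gcongr
        _ ≤ T k := ih (by omega)
  have mid : ∀ i ≤ K, T (k + i) ≤ T k * x ^ i := by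
    intro i
    induction i with
    | zero => simp
    | succ i ih =>
      intro hi
      calc T (k + (i + 1)) ≤ x * T (k + i) := h2 (k + i) (by omega) (by omega)
        _ ≤ x * (T k * x ^ i) := by gcongr; exact ih (by omega)
        _ = T k * x ^ (i + 1) := by ring
  -- Up to `k + K`, the quotient `T j / x ^ j` peaks at `j = k`, so one geometric sum covers both
  -- sides of `k`.
  have all : ∀ j ≤ k + K, T j * x ^ k ≤ T k * x ^ j := by
    intro j hj
    rcases le_total j k with h | h
    · have := low (k - j) (by omega)
      rw [Nat.sub_sub_self h] at this
      calc T j * x ^ k = (T j * x ^ (k - j)) * x ^ j := by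
            rw [mul_assoc, ← pow_add, Nat.sub_add_cancel h]
        _ ≤ _ := by gcongr
    · obtain ⟨i, rfl⟩ := Nat.exists_eq_add_of_le h
      calc T (k + i) * x ^ k ≤ T k * x ^ i * x ^ k := by gcongr; exact mid i (by omega)
        _ = _ := by rw [pow_add]; ring
  have high : ∀ i, k + K + i ≤ d → T (k + K + i) ≤ T k * x ^ K * q ^ i := by
    intro i
    induction i with
    | zero => simpa using fun _ => mid K le_rfl
    | succ i ih =>
      intro hi
      calc T (k + K + (i + 1)) ≤ q * T (k + K + i) := h3 (k + K + i) (by omega) (by omega)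
        _ ≤ q * (T k * x ^ K * q ^ i) := by gcongr; exact ih (by omega)
        _ = _ := by ring
  obtain ⟨e, rfl⟩ := Nat.exists_eq_add_of_le hkd
  rw [show k + K + e + 1 = (k + K + 1) + e by omega, Finset.sum_range_add, mul_add, mul_add]
  refine add_le_add ?_ ?_
  · have : (∑ j ∈ Finset.range (k + K + 1), T j) * x ^ k ≤
        T k * (x ^ K * (x / (x - 1))) * x ^ k := by
      calc (∑ j ∈ Finset.range (k + K + 1), T j) * x ^ k
          ≤ ∑ j ∈ Finset.range (k + K + 1), T k * x ^ j := by
            rw [Finset.sum_mul]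
            exact Finset.sum_le_sum fun j hj => all j (by simp at hj; omega)
        _ = T k * ((x ^ (k + K + 1) - 1) / (x - 1)) := by
            rw [← Finset.mul_sum, geom_sum_eq hx.ne']
        _ ≤ T k * (x ^ (k + K + 1) / (x - 1)) := by
            have : 0 < x - 1 := by linarith
            have := hT k
            gcongr
            linarith
        _ = _ := by rw [pow_succ, pow_add]; ring
    exact le_of_mul_le_mul_right this (by positivity)
  · calc ∑ i ∈ Finset.range e, T (k + K + 1 + i)
        ≤ ∑ i ∈ Finset.range e, T k * x ^ K * q * q ^ i := by
          refine Finset.sum_le_sum fun i hi => ?_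
          have := high (i + 1) (by simp at hi; omega)
          rw [show k + K + 1 + i = k + K + (i + 1) by omega]
          exact this.trans (le_of_eq (by ring))
      _ = T k * x ^ K * q * ∑ i ∈ Finset.range e, q ^ i := by rw [Finset.mul_sum]
      _ ≤ T k * x ^ K * q * (1 - q)⁻¹ := by
          have := hT k
          gcongr
          rw [← tsum_geometric_of_lt_one hq0 hq]
          exact (summable_geometric_of_lt_one hq0 hq).sum_le_tsum _ fun _ _ => by positivity
      _ = _ := by ring

/-- Evaluation of a log-concave sequence close to its `k`-th slope, compared with the slope of
index `kp > k`. -/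
theorem exists_sum_le_calUReal_right {w β : ℕ → ℝ} {d k kp : ℕ} (hw : ∀ j, 0 < w j)
    (hwβ : ∀ j < d, w j = β (j + 1) * w (j + 1)) (hβ : ∀ j, 0 < β j)
    (hmono : ∀ i j, 1 ≤ i → i ≤ j → j ≤ d → β i ≤ β j) (hk : 1 ≤ k) (hkp : k < kp)
    (hkd : kp ≤ d + 1) {δ : ℝ} (h0 : 0 ≤ δ) (h1 : δ < 1) (hδ : kp ≤ d → δ * β kp = β k)
    {s : ℝ} (hs : calUReal (kp - k - 1) δ < s) :
    ∃ r > 0, ∑ j ∈ Finset.range (d + 1), w j * r ^ j ≤ s * (w k * r ^ k) := by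
  obtain ⟨x, hx1, hxδ, hx⟩ := exists_geom_bound_le_calUReal _ h0 h1 hs
  have hx0 : 0 < x := by linarith
  have hr : 0 < x * β k := mul_pos hx0 (hβ k)
  refine ⟨x * β k, hr, ?_⟩
  set r := x * β k with hrdef
  -- Consecutive terms have ratio `x * β k / β (j + 1)`: at least `x` for `j < k`, at most `x` from
  -- `k` on, at most `x * δ` once `j + 1 ≥ kp`.
  have step : ∀ j < d, w (j + 1) * r ^ (j + 1) * β (j + 1) = r * (w j * r ^ j) := by
    intro j hj
    rw [hwβ j hj]; ring
  have hT : ∀ j, 0 < w j * r ^ j := fun j => mul_pos (hw j) (pow_pos hr j)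
  have := sum_le_of_ratio_bounds (T := fun j => w j * r ^ j) (k := k) (K := kp - k - 1) (d := d)
    (fun j => (hT j).le) hx1 (by positivity) hxδ (by omega) ?_ ?_ ?_
  · refine this.trans ?_
    rw [mul_comm s]
    exact mul_le_mul_of_nonneg_left hx (hT k).le
  · intro j hj
    have hb := hmono (j + 1) k (by omega) (by omega) (by omega)
    refine le_of_mul_le_mul_right ?_ (hβ (j + 1))
    rw [step j (by omega), hrdef]
    have := mul_pos hx0 (hT j)
    nlinarith
  · intro j hj hj'
    have hb := hmono k (j + 1) hk (by omega) (by omega)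
    refine le_of_mul_le_mul_right ?_ (hβ (j + 1))
    rw [step j (by omega), hrdef]
    have := mul_pos hx0 (hT j)
    nlinarith
  · intro j hj hj'
    have hb := hmono kp (j + 1) (by omega) (by omega) (by omega)
    refine le_of_mul_le_mul_right ?_ (hβ (j + 1))
    rw [step j (by omega)]
    have h : 0 ≤ x * δ * (w j * r ^ j) := mul_nonneg (by positivity) (hT j).le
    calc r * (w j * r ^ j) = x * δ * (w j * r ^ j) * β kp := by
          rw [show r = x * (δ * β kp) by rw [hδ (by omega)]]; ring
      _ ≤ _ := mul_le_mul_of_nonneg_left hb h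

/-- Evaluation of a log-concave sequence close to its `k`-th slope, compared with the slope of
index `km < k`. -/
theorem exists_sum_le_calUReal_left {w β : ℕ → ℝ} {d km k : ℕ} (hw : ∀ j, 0 < w j)
    (hwβ : ∀ j < d, w j = β (j + 1) * w (j + 1)) (hβ : ∀ j, 0 < β j)
    (hmono : ∀ i j, 1 ≤ i → i ≤ j → j ≤ d → β i ≤ β j) (hkm : km < k)
    (hkd : k ≤ d) {δ : ℝ} (h0 : 0 ≤ δ) (h1 : δ < 1) (hδ : 1 ≤ km → δ * β k = β km)
    {s : ℝ} (hs : calUReal (k - km) δ < s) :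
    ∃ r > 0, ∑ j ∈ Finset.range (d + 1), w j * r ^ j ≤ s * (w k * r ^ k) := by
  obtain ⟨x, hx1, hxδ, hx⟩ := exists_geom_bound_le_calUReal _ h0 h1 hs
  have hx0 : 0 < x := by linarith
  have hr : 0 < β k / x := div_pos (hβ k) hx0
  refine ⟨β k / x, hr, ?_⟩
  set r := β k / x with hrdef
  have hrx : x * r = β k := by rw [hrdef]; field_simp
  have step : ∀ j < d, r * (w j * r ^ j) = β (j + 1) * (w (j + 1) * r ^ (j + 1)) := by
    intro j hj
    rw [hwβ j hj]; ring
  have hT : ∀ j, 0 < w j * r ^ j := fun j => mul_pos (hw j) (pow_pos hr j)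
  -- In reverse order the ratios are `x * β (j + 1) / β k`. Since `r < β k`, the slope `β k` itself
  -- belongs to the middle range, hence `k - km` steps against `kp - k - 1` on the right.
  have := sum_le_of_ratio_bounds (T := fun j => w (d - j) * r ^ (d - j)) (k := d - k)
    (K := k - km) (d := d)
    (fun j => (hT _).le) hx1 (by positivity) hxδ (by omega) ?_ ?_ ?_
  · rw [Finset.sum_range_reflect (fun j => w j * r ^ j) (d + 1) |>.symm]
    refine (le_of_eq ?_).trans (this.trans ?_)
    · exact Finset.sum_congr rfl fun j _ => by simp
    · rw [mul_comm s, Nat.sub_sub_self hkd]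
      exact mul_le_mul_of_nonneg_left hx (hT k).le
  · intro j hj
    obtain ⟨i, rfl⟩ : ∃ i, d = j + i + 1 := ⟨d - j - 1, by omega⟩
    rw [show j + i + 1 - j = i + 1 by omega, show j + i + 1 - (j + 1) = i by omega]
    have hb := hmono k (i + 1) (by omega) (by omega) (by omega)
    refine le_of_mul_le_mul_left ?_ hr
    rw [step i (by omega), ← mul_assoc, mul_comm r x, hrx]
    exact mul_le_mul_of_nonneg_right hb (hT _).le
  · intro j hj hj'
    obtain ⟨i, rfl⟩ : ∃ i, d = j + i + 1 := ⟨d - j - 1, by omega⟩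
    rw [show j + i + 1 - j = i + 1 by omega, show j + i + 1 - (j + 1) = i by omega]
    have hb := hmono (i + 1) k (by omega) (by omega) (by omega)
    refine le_of_mul_le_mul_left ?_ hr
    rw [step i (by omega), ← mul_assoc r, mul_comm r x, hrx]
    exact mul_le_mul_of_nonneg_right hb (hT _).le
  · intro j hj hj'
    obtain ⟨i, rfl⟩ : ∃ i, d = j + i + 1 := ⟨d - j - 1, by omega⟩
    rw [show j + i + 1 - j = i + 1 by omega, show j + i + 1 - (j + 1) = i by omega]
    have hb := hmono (i + 1) km (by omega) (by omega) (by omega)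
    refine le_of_mul_le_mul_left ?_ hr
    rw [step i (by omega), ← mul_assoc r, show r * (x * δ) = δ * (x * r) by ring, hrx,
      hδ (by omega)]
    exact mul_le_mul_of_nonneg_right hb (hT _).le

/-! ### Tropical roots and the log-concave majorant. -/

/-- The finite tropical roots `α_1, …, α_d` as a sequence on `ℕ`, indexed from one. -/
def rootSeq {d : ℕ} (α : Fin d → ℝ) (j : ℕ) : ℝ :=
  -- The default 1 keeps all terms positive; the value at index 0 carries no meaning.
  if h : j - 1 < d then α ⟨j - 1, h⟩ else 1

/-- The log-concave majorant `a_d α_{j+1} ⋯ α_d` of the coefficients of a max-times polynomial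
with tropical roots `α`. -/
def majorant {d : ℕ} (ad : ℝ) (α : Fin d → ℝ) (j : ℕ) : ℝ :=
  ad * ∏ i ∈ Finset.Ico j d, rootSeq α (i + 1)

theorem rootSeq_succ {d : ℕ} (α : Fin d → ℝ) (i : Fin d) : rootSeq α (i + 1) = α i := by
  simp [rootSeq]

theorem rootSeq_pos {d : ℕ} {α : Fin d → ℝ} (hα : ∀ i, 0 < α i) (j : ℕ) : 0 < rootSeq α j := by
  unfold rootSeq
  split_ifs
  · exact hα _
  · exact one_pos

theorem rootSeq_mono {d : ℕ} {α : Fin d → ℝ} (hα : Monotone α) {i j : ℕ} (hi : 1 ≤ i)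
    (hij : i ≤ j) (hj : j ≤ d) : rootSeq α i ≤ rootSeq α j := by
  unfold rootSeq
  rw [dif_pos (by omega), dif_pos (by omega)]
  exact hα (by simp; omega)

theorem extSeq_eq_ofReal {d : ℕ} (α : Fin d → ℝ) {j : ℕ} (h1 : 1 ≤ j) (hj : j ≤ d) :
    extSeq α j = ENNReal.ofReal (rootSeq α j) := by
  obtain ⟨i, rfl⟩ := Nat.exists_eq_add_of_le' h1
  have h : i < d := by omega
  simp [extSeq, rootSeq, h]

theorem extSeq_monotone {d : ℕ} {α : Fin d → ℝ} (hα : Monotone α) : Monotone (extSeq α) := by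
  intro i j hij
  rcases Nat.eq_zero_or_pos i with rfl | hi
  · simp [extSeq]
  · by_cases hj : j ≤ d
    · rw [extSeq_eq_ofReal α hi (hij.trans hj), extSeq_eq_ofReal α (hi.trans_le hij) hj]
      exact ENNReal.ofReal_le_ofReal (rootSeq_mono hα hi hij hj)
    · obtain ⟨j, rfl⟩ : ∃ j', j = j' + 1 := ⟨j - 1, by omega⟩
      have h : ¬ j < d := by omega
      simp [extSeq, h]

theorem majorant_eq_mul_succ {d : ℕ} (ad : ℝ) (α : Fin d → ℝ) {j : ℕ} (hj : j < d) :
    majorant ad α j = rootSeq α (j + 1) * majorant ad α (j + 1) := by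
  rw [majorant, majorant, Finset.prod_eq_prod_Ico_succ_bot hj]
  ring

theorem majorant_pos {d : ℕ} {ad : ℝ} (had : 0 < ad) {α : Fin d → ℝ} (hα : ∀ i, 0 < α i) (j : ℕ) :
    0 < majorant ad α j :=
  mul_pos had (Finset.prod_pos fun _ _ => rootSeq_pos hα _)

theorem majorant_mul_prod {d : ℕ} (ad : ℝ) (α : Fin d → ℝ) {k : ℕ} (hk : k ≤ d) :
    majorant ad α k * ∏ j ∈ Finset.Icc 1 k, rootSeq α j = majorant ad α 0 := by
  induction k with
  | zero => simp
  | succ k ih =>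
    rw [← ih (by omega), majorant_eq_mul_succ ad α (j := k) (by omega),
      Finset.prod_Icc_succ_top (by omega)]
    ring

theorem prod_extSeq {d : ℕ} {α : Fin d → ℝ} (hα : ∀ i, 0 < α i) {k : ℕ} (hk : k ≤ d) :
    ∏ j ∈ Finset.Icc 1 k, extSeq α j = ENNReal.ofReal (∏ j ∈ Finset.Icc 1 k, rootSeq α j) := by
  rw [ENNReal.ofReal_prod_of_nonneg fun _ _ => (rootSeq_pos hα _).le]
  refine Finset.prod_congr rfl fun j hj => ?_
  rw [Finset.mem_Icc] at hj
  exact extSeq_eq_ofReal α hj.1 (hj.2.trans hk)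

/-- Evaluation of the tropical factorization at `x = 0`. -/
theorem IsTropicalRootList.coeff_zero {d : ℕ} {a : ℕ → ℝ} {α : Fin d → ℝ} (ha : ∀ j, 0 ≤ a j)
    (h : IsTropicalRootList d a α) : a 0 = majorant (a d) α 0 := by
  have h0 := h.2.2 0 le_rfl
  have h1 : tropEval d a 0 = a 0 := by
    refine le_antisymm (Finset.sup'_le _ _ fun j _ => ?_) ?_
    · rcases eq_or_ne j 0 with rfl | hj
      · simp
      · simpa [hj] using ha 0
    · exact (by simp : a 0 ≤ a 0 * 0 ^ 0).trans
        (Finset.le_sup' (fun j => a j * (0 : ℝ) ^ j) (by simp))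
  rw [← h1, h0, majorant, ← Finset.range_eq_Ico, ← Fin.prod_univ_eq_prod_range]
  congr 1
  exact Finset.prod_congr rfl fun i _ => by rw [rootSeq_succ, max_eq_right (h.2.1 i)]

theorem IsTropicalRootList.pos {d : ℕ} {a : ℕ → ℝ} {α : Fin d → ℝ} (ha : ∀ j, 0 ≤ a j)
    (h0 : a 0 ≠ 0) (h : IsTropicalRootList d a α) (i : Fin d) : 0 < α i := by
  refine (h.2.1 i).lt_of_ne fun hi => h0 ?_
  rw [h.coeff_zero ha, majorant, Finset.prod_eq_zero (i := i.val), mul_zero]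
  · simp
  · rw [rootSeq_succ, ← hi]

/-- For `j ≥ 1`, evaluate at `x = α_j`: monotonicity turns the product into `α_j^j α_{j+1} ⋯ α_d`,
and `α_j^j` cancels. -/
theorem IsTropicalRootList.coeff_le {d : ℕ} {a : ℕ → ℝ} {α : Fin d → ℝ} (ha : ∀ j, 0 ≤ a j)
    (h0 : a 0 ≠ 0) (h : IsTropicalRootList d a α) {j : ℕ} (hj : j ≤ d) :
    a j ≤ majorant (a d) α j := by
  rcases Nat.eq_zero_or_pos j with rfl | hj0
  · exact (h.coeff_zero ha).le
  have hpos := h.pos ha h0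
  have hβ := rootSeq_pos hpos j
  have h1 : a j * rootSeq α j ^ j ≤ tropEval d a (rootSeq α j) :=
    Finset.le_sup' (fun j' => a j' * rootSeq α j ^ j') (by simp; omega)
  have h2 : ∏ i, max (rootSeq α j) (α i) =
      ∏ i ∈ Finset.range d, max (rootSeq α j) (rootSeq α (i + 1)) := by
    rw [← Fin.prod_univ_eq_prod_range (fun i => max (rootSeq α j) (rootSeq α (i + 1)))]
    exact Finset.prod_congr rfl fun i _ => by rw [rootSeq_succ]
  rw [h.2.2 _ hβ.le, h2, Finset.range_eq_Ico, ← Finset.prod_Ico_consecutive _ (Nat.zero_le j) hj,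
    Finset.prod_congr (s₂ := Finset.Ico 0 j) rfl (g := fun _ => rootSeq α j) fun i hi => by
      rw [Finset.mem_Ico] at hi
      exact max_eq_left (rootSeq_mono h.1 (by omega) (by omega) hj),
    Finset.prod_congr (s₂ := Finset.Ico j d) rfl (g := fun i => rootSeq α (i + 1)) fun i hi => by
      rw [Finset.mem_Ico] at hi
      exact max_eq_right (rootSeq_mono h.1 (by omega) (by omega) (by omega))] at h1
  simp only [Finset.prod_const, Nat.card_Ico, Nat.sub_zero] at h1
  refine le_of_mul_le_mul_right (h1.trans (le_of_eq ?_)) (pow_pos hβ j)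
  rw [majorant]
  ring

/-! ### Products of eigenvalues and the Mahler measure. -/

theorem modulus_coe (z : ℂ) : modulus (z : OnePoint ℂ) = ENNReal.ofReal ‖z‖ := rfl

theorem modulus_infty : modulus OnePoint.infty = ⊤ := rfl

open Polynomial in
/-- A product of moduli of `m` eigenvalues is bounded below through the Mahler measure of
`det P(r λ)`. -/
theorem ofReal_le_mahlerMeasure_mul_prod_modulus {n d m : ℕ} {P : (Matrix (Fin n) (Fin n) ℂ)[X]}
    (hA0 : (P.coeff 0).det ≠ 0) {ζ : Fin (n * d) → OnePoint ℂ} (hζ : IsEigenvalueList P ζ)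
    (hm : m ≤ n * d) {r : ℝ} (hr : 0 < r) :
    ENNReal.ofReal (r ^ m * ‖(P.coeff 0).det‖) ≤
      ENNReal.ofReal ((detPoly P).comp (C (r : ℂ) * X)).mahlerMeasure *
        ∏ i : Fin (n * d) with i.val < m, modulus (ζ i) := by
  set p := detPoly P with hp
  have hp0 : p.eval 0 ≠ 0 := by rwa [hp, detPoly_eval_zero]
  have hpne : p ≠ 0 := fun h => hp0 (by simp [h])
  have hroot : ∀ z ∈ p.roots, z ≠ 0 := by
    rintro z hz rfl
    exact hp0 ((mem_roots hpne).mp hz)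
  -- The quotient `max r |ζ| / |ζ|`, extended by its limit 1 at infinity. Its product over all
  -- eigenvalues is the Mahler measure divided by `|det A_0|`.
  let g : OnePoint ℂ → ℝ≥0∞ := fun z => OnePoint.elim z 1 fun w => ENNReal.ofReal (max r ‖w‖ / ‖w‖)
  have hζmem : ∀ i, ζ i = OnePoint.infty ∨ ∃ z ∈ p.roots, ζ i = (z : OnePoint ℂ) := by
    intro i
    have : ζ i ∈ eigenvalues P := by
      rw [← hζ.1]
      exact Multiset.mem_map_of_mem _ (Finset.mem_univ i)
    rw [eigenvalues, Multiset.mem_add] at this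
    rcases this with h | h
    · obtain ⟨z, hz, h⟩ := Multiset.mem_map.mp h
      exact Or.inr ⟨z, hz, h.symm⟩
    · exact Or.inl (Multiset.eq_of_mem_replicate h)
  have hg1 : ∀ i, 1 ≤ g (ζ i) := by
    intro i
    rcases hζmem i with h | ⟨z, hz, h⟩
    · rw [h]; exact le_rfl
    · rw [h]
      have : 0 < ‖z‖ := norm_pos_iff.mpr (hroot z hz)
      change 1 ≤ ENNReal.ofReal _
      rw [ENNReal.one_le_ofReal, le_div_iff₀ this, one_mul]
      exact le_max_right _ _
  have hgr : ∀ i, ENNReal.ofReal r ≤ g (ζ i) * modulus (ζ i) := by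
    intro i
    rcases hζmem i with h | ⟨z, hz, h⟩
    · rw [h, modulus_infty]
      change _ ≤ 1 * ⊤
      simp
    · rw [h, modulus_coe]
      have : 0 < ‖z‖ := norm_pos_iff.mpr (hroot z hz)
      change _ ≤ ENNReal.ofReal _ * _
      rw [← ENNReal.ofReal_mul (by positivity), div_mul_cancel₀ _ this.ne']
      exact ENNReal.ofReal_le_ofReal (le_max_left _ _)
  have hprod : ENNReal.ofReal ‖(P.coeff 0).det‖ * ∏ i, g (ζ i) =
      ENNReal.ofReal (p.comp (C (r : ℂ) * X)).mahlerMeasure := by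
    have h1 : ∏ i, g (ζ i) = ((eigenvalues P).map g).prod := by
      rw [← hζ.1, Multiset.map_map]; rfl
    have h2 : (p.roots.map fun z : ℂ => g z).prod =
        ENNReal.ofReal (p.roots.map fun z => max r ‖z‖ / ‖z‖).prod := by
      generalize p.roots = S
      induction S using Multiset.induction_on with
      | empty => simp
      | cons z S ih =>
        rw [Multiset.map_cons, Multiset.prod_cons, Multiset.map_cons, Multiset.prod_cons,
          ENNReal.ofReal_mul (by positivity), ih]
        rfl
    have h3 : ‖(P.coeff 0).det‖ = ‖p.leadingCoeff‖ * (p.roots.map fun z => ‖z‖).prod := by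
      rw [← detPoly_eval_zero, ← hp]
      nth_rw 1 [(IsAlgClosed.splits p).eq_prod_roots]
      rw [eval_mul, eval_C, norm_mul, eval_multiset_prod, Multiset.map_map]
      congr 1
      rw [← coe_nnnorm, ← nnnormHom_apply, map_multiset_prod, Multiset.map_map]
      push_cast
      rw [Multiset.map_map]
      congr 1
      refine Multiset.map_congr rfl fun z _ => ?_
      simp
    have h4 : (p.roots.map fun z => ‖z‖).prod ≠ 0 := by
      rw [ne_eq, Multiset.prod_eq_zero_iff, Multiset.mem_map]
      rintro ⟨z, hz, h⟩
      exact hroot z hz (norm_eq_zero.mp h)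
    rw [h1, eigenvalues, Multiset.map_add, Multiset.prod_add, Multiset.map_map,
      Multiset.map_replicate, Multiset.prod_replicate]
    change _ * ((p.roots.map fun z : ℂ => g z).prod * 1 ^ _) = _
    rw [one_pow, mul_one, h2, ← ENNReal.ofReal_mul (norm_nonneg _), mahlerMeasure_comp_C_mul_X hr.le,
      h3, Multiset.prod_map_div, mul_assoc, mul_div_cancel₀ _ h4]
  have hcard : (Finset.univ.filter fun i : Fin (n * d) => i.val < m).card = m := by
    rw [Fin.card_filter_val_lt, min_eq_right hm]
  calc ENNReal.ofReal (r ^ m * ‖(P.coeff 0).det‖)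
      = ENNReal.ofReal ‖(P.coeff 0).det‖ *
          ∏ i : Fin (n * d) with i.val < m, ENNReal.ofReal r := by
        rw [Finset.prod_const, hcard, mul_comm, ENNReal.ofReal_mul (norm_nonneg _),
          ENNReal.ofReal_pow hr.le]
    _ ≤ ENNReal.ofReal ‖(P.coeff 0).det‖ *
          ∏ i : Fin (n * d) with i.val < m, (g (ζ i) * modulus (ζ i)) := by
        gcongr
        exact hgr _
    _ ≤ ENNReal.ofReal ‖(P.coeff 0).det‖ *
          ((∏ i, g (ζ i)) * ∏ i : Fin (n * d) with i.val < m, modulus (ζ i)) := by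
        rw [Finset.prod_mul_distrib]
        gcongr
        · exact fun i _ _ => hg1 i
        · exact Finset.filter_subset _ _
    _ = _ := by rw [← mul_assoc, hprod]

/-! ### Upper bounds for the Mahler measure under (A1) and (A2). -/

theorem normFrob_real_smul {n : ℕ} {r : ℝ} (hr : 0 ≤ r) (A : Matrix (Fin n) (Fin n) ℂ) :
    normFrob ((r : ℂ) • A) = r * normFrob A := by
  refine (sq_eq_sq₀ (normFrob_nonneg _) (mul_nonneg hr (normFrob_nonneg _))).mp ?_
  rw [mul_pow, normFrob_sq, normFrob_sq]
  simp only [Matrix.smul_apply, smul_eq_mul, norm_mul, mul_pow, ← Finset.mul_sum]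
  rw [Complex.norm_real, Real.norm_eq_abs, sq_abs]
  ring

theorem continuous_normFrob_sum {n : ℕ} (m : ℕ) (A : ℕ → Matrix (Fin n) (Fin n) ℂ) :
    Continuous fun z : ℂ => normFrob (∑ j ∈ Finset.range m, z ^ j • A j) := by
  unfold normFrob
  simp only [Matrix.sum_apply, Matrix.smul_apply, smul_eq_mul]
  fun_prop

open Polynomial in
theorem detPoly_comp_eval {n : ℕ} (P : (Matrix (Fin n) (Fin n) ℂ)[X]) (r z : ℂ) :
    ((detPoly P).comp (C r * X)).eval z =
      (∑ j ∈ Finset.range (P.natDegree + 1), z ^ j • (r ^ j • P.coeff j)).det := by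
  rw [eval_comp, detPoly_eval]
  simp only [eval_mul, eval_C, eval_X, mul_pow, smul_smul, mul_comm]

open Polynomial in
theorem detPoly_comp_ne_zero {n : ℕ} {P : (Matrix (Fin n) (Fin n) ℂ)[X]}
    (hA0 : (P.coeff 0).det ≠ 0) (r : ℂ) : (detPoly P).comp (C r * X) ≠ 0 := by
  intro h
  have := congrArg (eval 0) h
  rw [eval_comp] at this
  simp only [eval_mul, eval_C, eval_X, mul_zero, eval_zero, detPoly_eval_zero] at this
  exact hA0 this

-- The triangle inequality bounds `N` by `B` on the whole circle, so a constant `f` suffices in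
-- Jensen's inequality.
open Polynomial in
theorem mahlerMeasure_detPoly_sq_le_of_detBounded {n : ℕ} (hn : n ≠ 0)
    {P : (Matrix (Fin n) (Fin n) ℂ)[X]} (hA0 : (P.coeff 0).det ≠ 0)
    {N : Seminorm ℂ (Matrix (Fin n) (Fin n) ℂ)} (hN : DetBounded N) {r : ℝ} (hr : 0 ≤ r) {B : ℝ}
    (hB0 : 0 < B) (hB : ∑ j ∈ Finset.range (P.natDegree + 1), N (P.coeff j) * r ^ j ≤ B) :
    ((detPoly P).comp (C (r : ℂ) * X)).mahlerMeasure ^ 2 ≤ (B ^ 2) ^ n := by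
  refine mahlerMeasure_sq_le (detPoly_comp_ne_zero hA0 _) hn (f := fun _ => B ^ 2)
    continuous_const (fun _ => by positivity) (fun z hz => ?_) (by positivity)
    (by rw [Real.circleAverage_const])
  rw [detPoly_comp_eval, pow_right_comm]
  refine pow_le_pow_left₀ (norm_nonneg _) ((hN _).trans ?_) 2
  refine pow_le_pow_left₀ (apply_nonneg N _) (le_trans ?_ hB) n
  refine (Finset.le_sum_of_subadditive N (map_zero N).le (map_add_le_add N) _ _).trans (le_of_eq ?_)
  refine Finset.sum_congr rfl fun j _ => ?_
  rw [map_smul_eq_mul, map_smul_eq_mul, norm_pow, norm_pow, hz, Complex.norm_real,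
    Real.norm_of_nonneg hr]
  ring

-- Multiplication by `Q` and `Q'` preserves the determinant. Averaging the squared Frobenius norm by
-- Parseval removes the cross terms and leaves a sum of squares.
open Polynomial in
theorem mahlerMeasure_detPoly_sq_le_of_frobDominated {n : ℕ} (hn : n ≠ 0)
    {P : (Matrix (Fin n) (Fin n) ℂ)[X]} (hA0 : (P.coeff 0).det ≠ 0)
    {N : Seminorm ℂ (Matrix (Fin n) (Fin n) ℂ)} (hN : FrobDominated N) {r : ℝ} (hr : 0 ≤ r) {B : ℝ}
    (hB0 : 0 < B)
    (hB : ∑ j ∈ Finset.range (P.natDegree + 1), N (P.coeff j) ^ 2 * (r ^ 2) ^ j ≤ B) :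
    ((detPoly P).comp (C (r : ℂ) * X)).mahlerMeasure ^ 2 ≤ B ^ n := by
  obtain ⟨Q, Q', hQ, hQ', hQQ⟩ := hN
  let A : ℕ → Matrix (Fin n) (Fin n) ℂ := fun j => ((r ^ j : ℝ) : ℂ) • (Q * P.coeff j * Q')
  refine mahlerMeasure_sq_le (detPoly_comp_ne_zero hA0 _) hn
    (f := fun z => normFrob (∑ j ∈ Finset.range (P.natDegree + 1), z ^ j • A j) ^ 2)
    ((continuous_normFrob_sum _ _).pow 2) (fun _ => by positivity) (fun z hz => ?_) hB0 ?_
  · have : ∑ j ∈ Finset.range (P.natDegree + 1), z ^ j • A j =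
        Q * (∑ j ∈ Finset.range (P.natDegree + 1), z ^ j • ((r : ℂ) ^ j • P.coeff j)) * Q' := by
      rw [Finset.mul_sum, Finset.sum_mul]
      refine Finset.sum_congr rfl fun j _ => ?_
      simp [A]
    rw [this]
    refine le_trans (le_of_eq ?_) (norm_det_sq_le_normFrob hn _)
    rw [detPoly_comp_eval, Matrix.det_mul, Matrix.det_mul, hQ, hQ', one_mul, mul_one]
  · rw [circleAverage_normFrob_sq]
    refine le_trans (Finset.sum_le_sum fun j _ => ?_) hB
    rw [normFrob_real_smul (by positivity), mul_pow, mul_comm, pow_right_comm]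
    exact mul_le_mul_of_nonneg_right (pow_le_pow_left₀ (normFrob_nonneg _) (hQQ _) 2)
      (by positivity)

theorem size_ne_zero_of_natDegree_pos {n k : ℕ} {P : (Matrix (Fin n) (Fin n) ℂ)[X]} (hk : 0 < k)
    (hkd : k ≤ P.natDegree) : n ≠ 0 := by
  rintro rfl
  have : P = 0 := Polynomial.ext fun j => Matrix.ext fun i => i.elim0
  rw [this, Polynomial.natDegree_zero] at hkd
  omega

open Polynomial in
/-- A Mahler measure estimate at radius `r` gives a lower bound for the product of the moduli. -/
theorem ratio_ge_of_mahlerMeasure_sq_le {n d k : ℕ} {P : (Matrix (Fin n) (Fin n) ℂ)[X]}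
    (hA0 : (P.coeff 0).det ≠ 0) {ζ : Fin (n * d) → OnePoint ℂ} (hζ : IsEigenvalueList P ζ)
    {α : Fin d → ℝ} (hα : ∀ i, 0 < α i) (hk : k ≤ d) {a0 ad : ℝ} (had : 0 < ad)
    (ha0 : a0 = majorant ad α 0) {r t : ℝ} (hr : 0 < r) (ht : 0 < t)
    (hM : ((detPoly P).comp (C (r : ℂ) * X)).mahlerMeasure ^ 2 ≤
      ((t * (majorant ad α k * r ^ k)) ^ 2) ^ n) :
    ENNReal.ofReal (‖(P.coeff 0).det‖ / a0 ^ n) * ENNReal.ofReal (1 / t) ^ n ≤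
      (∏ i : Fin (n * d) with i.val < n * k, modulus (ζ i)) /
        (∏ j ∈ Finset.Icc 1 k, extSeq α j) ^ n := by
  have hw := majorant_pos had hα k
  have hX : 0 < ∏ j ∈ Finset.Icc 1 k, rootSeq α j :=
    Finset.prod_pos fun j _ => rootSeq_pos hα j
  -- This identity turns `|det A_0| / w_k^n` into `c (α_1 ⋯ α_k)^n`.
  have hwX := majorant_mul_prod ad α hk
  rw [← ha0] at hwX
  rw [prod_extSeq hα hk]
  set X := ∏ j ∈ Finset.Icc 1 k, rootSeq α j
  set w := majorant ad α k
  set Y := (t * (w * r ^ k)) ^ n with hY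
  have hYpos : 0 < Y := by positivity
  have hMY : ((detPoly P).comp (C (r : ℂ) * Polynomial.X)).mahlerMeasure ≤ Y := by
    refine le_of_sq_le_sq ?_ hYpos.le
    rwa [hY, pow_right_comm]
  have h1 := ofReal_le_mahlerMeasure_mul_prod_modulus hA0 hζ (Nat.mul_le_mul_left n hk) hr
  have h2 : ENNReal.ofReal (r ^ (n * k) * ‖(P.coeff 0).det‖ / Y) ≤
      ∏ i : Fin (n * d) with i.val < n * k, modulus (ζ i) := by
    rw [ENNReal.ofReal_div_of_pos hYpos]
    refine ENNReal.div_le_of_le_mul' (h1.trans ?_)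
    gcongr
  have hX0 : ENNReal.ofReal X ^ n ≠ 0 := pow_ne_zero _ (by simpa using hX)
  rw [ENNReal.le_div_iff_mul_le (Or.inl hX0) (Or.inl (by finiteness))]
  refine le_trans (le_of_eq ?_) h2
  rw [← ENNReal.ofReal_pow (by positivity), ← ENNReal.ofReal_pow hX.le,
    ← ENNReal.ofReal_mul (by rw [← hwX]; positivity), ← ENNReal.ofReal_mul (by rw [← hwX]; positivity)]
  congr 1
  rw [hY, ← hwX]
  simp only [mul_pow, div_pow, one_pow]
  rw [pow_right_comm, pow_mul, pow_right_comm]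
  field_simp

/-! ### The limit `s → 𝒰` and the case `δ = 1`. -/

/-- Passage to the limit in lower bounds of the form `c (1/t)^n`. -/
theorem mul_one_div_pow_le_of_forall_gt {c R : ℝ≥0∞} (hc : c ≠ ⊤) {n : ℕ} {u : ℝ} (hu : 0 < u)
    (h : ∀ t, u < t → c * ENNReal.ofReal (1 / t) ^ n ≤ R) :
    c * ENNReal.ofReal (1 / u) ^ n ≤ R := by
  have hcont : Filter.Tendsto (fun t : ℝ => c * ENNReal.ofReal (1 / t) ^ n)
      (nhdsWithin u (Set.Ioi u)) (nhds (c * ENNReal.ofReal (1 / u) ^ n)) := by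
    refine Filter.Tendsto.mono_left ?_ nhdsWithin_le_nhds
    refine ENNReal.Tendsto.const_mul (ENNReal.Tendsto.pow ?_) (Or.inr hc)
    exact ENNReal.tendsto_ofReal (tendsto_const_nhds.div Filter.tendsto_id hu.ne')
  exact le_of_tendsto hcont (Filter.eventually_of_mem self_mem_nhdsWithin h)

theorem one_div_calU {k : ℕ} {δ : ℝ} (h0 : 0 ≤ δ) (h1 : δ < 1) :
    1 / calU k δ = ENNReal.ofReal (1 / calUReal k δ) := by
  rw [calU_eq_ofReal h1, ENNReal.ofReal_div_of_pos (calUReal_pos k h0 h1), ENNReal.ofReal_one]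

theorem one_div_sqrt_calU {k : ℕ} {δ : ℝ} (h0 : 0 ≤ δ) (h1 : δ < 1) :
    1 / calU k (δ ^ 2) ^ (1 / 2 : ℝ) =
      ENNReal.ofReal (1 / Real.sqrt (calUReal k (δ ^ 2))) := by
  have h2 : δ ^ 2 < 1 := by nlinarith
  have h3 := calUReal_pos k (sq_nonneg δ) h2
  rw [calU_eq_ofReal h2, ENNReal.ofReal_rpow_of_nonneg h3.le (by norm_num), ← Real.sqrt_eq_rpow,
    ENNReal.ofReal_div_of_pos (Real.sqrt_pos.mpr h3), ENNReal.ofReal_one]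

theorem one_div_calU_le_sqrt {k : ℕ} {δ : ℝ} (h0 : 0 ≤ δ) (h1 : δ ≤ 1) :
    1 / calU k δ ≤ 1 / calU k (δ ^ 2) ^ (1 / 2 : ℝ) := by
  rcases h1.eq_or_lt with rfl | h1
  · simp [calU_one]
  · rw [one_div_calU h0 h1, one_div_sqrt_calU h0 h1]
    refine ENNReal.ofReal_le_ofReal (one_div_le_one_div_of_le ?_ ?_)
    · exact Real.sqrt_pos.mpr (calUReal_pos k (sq_nonneg δ) (by nlinarith))
    · exact Real.sqrt_le_iff.mpr ⟨(calUReal_pos k h0 h1).le, calUReal_sq_le k h0 h1⟩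

/-- At `δ = 1` the left side is 0 because `n ≠ 0`; otherwise `s` decreases to `𝒰`. -/
theorem bound_of_forall_gt_calUReal {c R : ℝ≥0∞} (hc : c ≠ ⊤) {n : ℕ} (hn : n ≠ 0) {k : ℕ} {δ : ℝ}
    (h0 : 0 ≤ δ) (h1 : δ ≤ 1)
    (h : δ < 1 → ∀ s, calUReal k δ < s → c * ENNReal.ofReal (1 / s) ^ n ≤ R) :
    c * (1 / calU k δ) ^ n ≤ R := by
  rcases h1.eq_or_lt with rfl | h1
  · simp [calU_one, hn]
  · rw [one_div_calU h0 h1]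
    exact mul_one_div_pow_le_of_forall_gt hc (calUReal_pos k h0 h1) (h h1)

theorem sqrt_bound_of_forall_gt_calUReal {c R : ℝ≥0∞} (hc : c ≠ ⊤) {n : ℕ} (hn : n ≠ 0) {k : ℕ}
    {δ : ℝ} (h0 : 0 ≤ δ) (h1 : δ ≤ 1)
    (h : δ < 1 → ∀ s, calUReal k (δ ^ 2) < s → c * ENNReal.ofReal (1 / Real.sqrt s) ^ n ≤ R) :
    c * (1 / calU k (δ ^ 2) ^ (1 / 2 : ℝ)) ^ n ≤ R := by
  rcases h1.eq_or_lt with rfl | h1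
  · simp [calU_one, hn]
  · have hu := calUReal_pos k (sq_nonneg δ) (by nlinarith)
    rw [one_div_sqrt_calU h0 h1]
    refine mul_one_div_pow_le_of_forall_gt hc (Real.sqrt_pos.mpr hu) fun t ht => ?_
    have ht0 : 0 < t := (Real.sqrt_nonneg _).trans_lt ht
    have := h h1 (t ^ 2) ((Real.sqrt_lt' ht0).mp ht)
    rwa [Real.sqrt_sq ht0.le] at this

end MatPoly

end

/-! ### Assembly of the bounds. -/

open MatPoly in
theorem theorem4p3 (n d : ℕ) (P : Polynomial (Matrix (Fin n) (Fin n) ℂ))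
    (hd : P.natDegree = d) (hA0 : (P.coeff 0).det ≠ 0)
    (N : Seminorm ℂ (Matrix (Fin n) (Fin n) ℂ)) (hN : MatPoly.IsNorm N)
    (hA1 : MatPoly.DetBounded N)
    (ζ : Fin (n * d) → OnePoint ℂ) (hζ : MatPoly.IsEigenvalueList P ζ)
    (α : Fin d → ℝ) (hα : MatPoly.IsTropicalRootList d (fun j => N (P.coeff j)) α)
    (km k kp : ℕ) (hkm : km < k) (hkp : k < kp) (hkd : kp ≤ d + 1)
    (c : ENNReal) (hc : c = ENNReal.ofReal (‖(P.coeff 0).det‖ / N (P.coeff 0) ^ n))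
    (δm δp : ENNReal) (hδm : δm = MatPoly.extSeq α km / MatPoly.extSeq α k)
    (hδp : δp = MatPoly.extSeq α k / MatPoly.extSeq α kp) :
    δm ≤ 1 ∧ δp ≤ 1 ∧
    (∏ i : Fin (n * d) with i.val < n * k, MatPoly.modulus (ζ i)) /
        (∏ j ∈ Finset.Icc 1 k, MatPoly.extSeq α j) ^ n ≥
      c * MatPoly.boundL km k kp δm.toReal δp.toReal ^ n ∧
    (MatPoly.FrobDominated N →
      MatPoly.boundL km k kp δm.toReal δp.toReal ≤
        MatPoly.boundLStar km k kp δm.toReal δp.toReal ∧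
      (∏ i : Fin (n * d) with i.val < n * k, MatPoly.modulus (ζ i)) /
          (∏ j ∈ Finset.Icc 1 k, MatPoly.extSeq α j) ^ n ≥
        c * MatPoly.boundLStar km k kp δm.toReal δp.toReal ^ n) := by
  have hn : n ≠ 0 := size_ne_zero_of_natDegree_pos (P := P) (k := k) (by omega) (by omega)
  have hk1 : 1 ≤ k := by omega
  have hkd' : k ≤ d := by omega
  have ha : ∀ j, 0 ≤ N (P.coeff j) := fun j => apply_nonneg N _
  have ha0 : N (P.coeff 0) ≠ 0 := fun h => hA0 (by
    rw [hN _ h]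
    have : Nonempty (Fin n) := ⟨⟨0, Nat.pos_of_ne_zero hn⟩⟩
    exact Matrix.det_zero)
  have had : 0 < N (P.coeff d) := (ha d).lt_of_ne fun h => by
    have : P = 0 := by
      rw [← Polynomial.leadingCoeff_eq_zero, Polynomial.leadingCoeff, hd]
      exact hN _ h.symm
    rw [this, Polynomial.natDegree_zero] at hd
    omega
  have hαpos := hα.pos ha ha0
  have hβ := rootSeq_pos hαpos
  have hmono : ∀ i j, 1 ≤ i → i ≤ j → j ≤ d → rootSeq α i ≤ rootSeq α j :=
    fun i j hi hij hj => rootSeq_mono hα.1 hi hij hj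
  have hw := majorant_pos had hαpos
  have hwβ : ∀ j < d, majorant (N (P.coeff d)) α j =
      rootSeq α (j + 1) * majorant (N (P.coeff d)) α (j + 1) :=
    fun j hj => majorant_eq_mul_succ _ α hj
  have hδm1 : δm ≤ 1 := by
    rw [hδm]
    exact ENNReal.div_le_of_le_mul (by simpa using extSeq_monotone hα.1 hkm.le)
  have hδp1 : δp ≤ 1 := by
    rw [hδp]
    exact ENNReal.div_le_of_le_mul (by simpa using extSeq_monotone hα.1 hkp.le)
  have hx0 : 0 ≤ δm.toReal := ENNReal.toReal_nonneg
  have hy0 : 0 ≤ δp.toReal := ENNReal.toReal_nonneg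
  have hx1 : δm.toReal ≤ 1 := ENNReal.toReal_le_of_le_ofReal zero_le_one (by simpa using hδm1)
  have hy1 : δp.toReal ≤ 1 := ENNReal.toReal_le_of_le_ofReal zero_le_one (by simpa using hδp1)
  -- For `km = 0` or `kp = d + 1` the ratio is 0 and the range of factor `x * δ` is empty, so no
  -- relation is needed there.
  have hx : 1 ≤ km → δm.toReal * rootSeq α k = rootSeq α km := by
    intro h
    rw [hδm, extSeq_eq_ofReal α hk1 hkd', extSeq_eq_ofReal α h (by omega),
      ← ENNReal.ofReal_div_of_pos (hβ k),
      ENNReal.toReal_ofReal (div_pos (hβ km) (hβ k)).le, div_mul_cancel₀ _ (hβ k).ne']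
  have hy : kp ≤ d → δp.toReal * rootSeq α kp = rootSeq α k := by
    intro h
    rw [hδp, extSeq_eq_ofReal α hk1 hkd', extSeq_eq_ofReal α (by omega) h,
      ← ENNReal.ofReal_div_of_pos (hβ kp),
      ENNReal.toReal_ofReal (div_pos (hβ k) (hβ kp)).le, div_mul_cancel₀ _ (hβ kp).ne']
  have hctop : c ≠ ⊤ := by rw [hc]; exact ENNReal.ofReal_ne_top
  set w := majorant (N (P.coeff d)) α with hwdef
  have hle : ∀ j ∈ Finset.range (P.natDegree + 1), N (P.coeff j) ≤ w j := fun j hj =>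
    hα.coeff_le ha ha0 (by rw [Finset.mem_range] at hj; omega)
  have bound : ∀ s, 0 < s →
      (∃ r > 0, ∑ j ∈ Finset.range (d + 1), w j * r ^ j ≤ s * (w k * r ^ k)) →
      c * ENNReal.ofReal (1 / s) ^ n ≤
        (∏ i : Fin (n * d) with i.val < n * k, modulus (ζ i)) /
          (∏ j ∈ Finset.Icc 1 k, extSeq α j) ^ n := by
    rintro s hs ⟨r, hr, hsum⟩
    rw [hc]
    refine ratio_ge_of_mahlerMeasure_sq_le hA0 hζ hαpos hkd' had (hα.coeff_zero ha) hr hs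
      (mahlerMeasure_detPoly_sq_le_of_detBounded hn hA0 hA1 hr.le ?_ (le_trans ?_ hsum))
    · have := hw k
      positivity
    · rw [hd] at hle ⊢
      exact Finset.sum_le_sum fun j hj =>
        mul_le_mul_of_nonneg_right (hle j hj) (pow_nonneg hr.le j)
  refine ⟨hδm1, hδp1, ?_, fun hF => ⟨?_, ?_⟩⟩
  · rw [ge_iff_le, boundL]
    rcases max_choice (1 / calU (kp - k - 1) δp.toReal) (1 / calU (k - km) δm.toReal) with h | h
    · rw [h]
      exact bound_of_forall_gt_calUReal hctop hn hy0 hy1 fun h1 s hs =>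
        bound s ((calUReal_pos _ hy0 h1).trans hs)
          (exists_sum_le_calUReal_right hw hwβ hβ hmono hk1 hkp hkd hy0 h1 hy hs)
    · rw [h]
      exact bound_of_forall_gt_calUReal hctop hn hx0 hx1 fun h1 s hs =>
        bound s ((calUReal_pos _ hx0 h1).trans hs)
          (exists_sum_le_calUReal_left hw hwβ hβ hmono hkm hkd' hx0 h1 hx hs)
  · exact max_le_max (one_div_calU_le_sqrt hy0 hy1) (one_div_calU_le_sqrt hx0 hx1)
  -- Squaring `w_j` and the roots preserves the recurrence and the monotonicity, so the same sum
  -- estimates apply with radius `ρ = r²`.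
  have bound_sq : ∀ s, 0 < s →
      (∃ r > 0, ∑ j ∈ Finset.range (d + 1), w j ^ 2 * r ^ j ≤ s * (w k ^ 2 * r ^ k)) →
      c * ENNReal.ofReal (1 / Real.sqrt s) ^ n ≤
        (∏ i : Fin (n * d) with i.val < n * k, modulus (ζ i)) /
          (∏ j ∈ Finset.Icc 1 k, extSeq α j) ^ n := by
    rintro s hs ⟨ρ, hρ, hsum⟩
    obtain ⟨r, hr, rfl⟩ : ∃ r > 0, r ^ 2 = ρ :=
      ⟨Real.sqrt ρ, Real.sqrt_pos.mpr hρ, Real.sq_sqrt hρ.le⟩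
    have hwk := hw k
    have hs' := Real.sqrt_pos.mpr hs
    rw [hc]
    refine ratio_ge_of_mahlerMeasure_sq_le hA0 hζ hαpos hkd' had (hα.coeff_zero ha) hr hs'
      (mahlerMeasure_detPoly_sq_le_of_frobDominated hn hA0 hF hr.le (by positivity)
        (le_trans ?_ (hsum.trans (le_of_eq ?_))))
    · rw [hd] at hle ⊢
      exact Finset.sum_le_sum fun j hj =>
        mul_le_mul_of_nonneg_right (pow_le_pow_left₀ (ha j) (hle j hj) 2) (by positivity)
    · rw [mul_pow, mul_pow, Real.sq_sqrt hs.le, pow_right_comm]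
  have hw2 : ∀ j, 0 < w j ^ 2 := fun j => pow_pos (hw j) 2
  have hβ2 : ∀ j, 0 < rootSeq α j ^ 2 := fun j => pow_pos (hβ j) 2
  have hwβ2 : ∀ j < d, w j ^ 2 = rootSeq α (j + 1) ^ 2 * w (j + 1) ^ 2 := fun j hj => by
    rw [hwβ j hj, mul_pow]
  have hmono2 : ∀ i j, 1 ≤ i → i ≤ j → j ≤ d → rootSeq α i ^ 2 ≤ rootSeq α j ^ 2 :=
    fun i j hi hij hj => pow_le_pow_left₀ (hβ i).le (hmono i j hi hij hj) 2
  rw [ge_iff_le, boundLStar]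
  rcases max_choice (1 / calU (kp - k - 1) (δp.toReal ^ 2) ^ (1 / 2 : ℝ))
    (1 / calU (k - km) (δm.toReal ^ 2) ^ (1 / 2 : ℝ)) with h | h
  · rw [h]
    refine sqrt_bound_of_forall_gt_calUReal hctop hn hy0 hy1 fun h1 s hs => ?_
    have h2 : δp.toReal ^ 2 < 1 := by nlinarith
    exact bound_sq s ((calUReal_pos _ (sq_nonneg _) h2).trans hs)
      (exists_sum_le_calUReal_right hw2 hwβ2 hβ2 hmono2 hk1 hkp hkd (sq_nonneg _) h2
        (fun h => by rw [← mul_pow, hy h]) hs)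
  · rw [h]
    refine sqrt_bound_of_forall_gt_calUReal hctop hn hx0 hx1 fun h1 s hs => ?_
    have h2 : δm.toReal ^ 2 < 1 := by nlinarith
    exact bound_sq s ((calUReal_pos _ (sq_nonneg _) h2).trans hs)
      (exists_sum_le_calUReal_left hw2 hwβ2 hβ2 hmono2 hkm hkd' (sq_nonneg _) h2
        (fun h => by rw [← mul_pow, hx h]) hs)
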